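/- **Theorem (Strong Converse).** Fix $d\in\mathbb{N}$ and let $\mathcal{H}=\mathbb{C}^d$. A *state* is a positive semidefinite operator of trace one on $\mathcal{H}$; logarithms are to base $2$, and $H(\rho)=-\operatorname{Tr}(\rho\log\rho)$. A *nonstationary q-DMC* on $\mathcal{H}$ is a sequence $W=(W_1,W_2,\ldots)$ of nonempty sets of states. For a set $V$ of states let $$C(V)=\sup_P\Bigl[H\Bigl(\sum_\rho P(\rho)\rho\Bigr)-\sum_\rho P(\rho)H(\rho)\Bigr],$$ the supremum being over all finitely supported probability distributions $P$ on $V$. An *$n$-block code* for $W$ consists of a finite set $M$ of messages, a countable set $M'\supseteq M$, a map $f:M\to W_1\times\cdots\times W_n$, where $(\rho_1,\ldots,\rho_n)$ is identified with the product state $\rho_1\otimes\cdots\otimes\rho_n$, and an observable on $\mathcal{H}^{\otimes n}$ indexed by $M'$, that is, positive semidefinite operators $D_m$ ($m\in M'$) with $\sum_{m\in M'}D_m=\mathbb{1}$. It is an *$(n,\lambda)$-code* if $1-\operatorname{Tr}(f(m)D_m)\le\lambda$ for every $m\in M$, and $N(n,\lambda)$ is the maximal size $|M|$ of an $(n,\lambda)$-code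 for $W$. For every $\lambda\in(0,1)$ and $\epsilon>0$ there is $n_0=n_0(d,\lambda,\epsilon)$ such that for every $n\ge n_0$ and every nonstationary q-DMC $W$ on $\mathcal{H}$ $$\log N(n,\lambda)\le\sum_{i=1}^n C(W_i)+n\epsilon .$$ -/

import Mathlib

open scoped ComplexOrder

namespace QChannel

noncomputable section

/-- A state on `L(H)`, where `H = ℂ^d`, given by its density operator: a positive semidefinite
complex `d × d` matrix of trace one. -/
def State (d : ℕ) : Type :=
  {ρ : Matrix (Fin d) (Fin d) ℂ // ρ.PosSemidef ∧ ρ.trace = 1}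

/-- The operators on the `n`-fold tensor power `H ⊗ ⋯ ⊗ H` of `H = ℂ^d`, as matrices with respect
to the product basis `e_x = e_{x 0} ⊗ ⋯ ⊗ e_{x (n - 1)}`, which is indexed by `x : Fin n → Fin d`. -/
abbrev TensorOp (d n : ℕ) : Type :=
  Matrix (Fin n → Fin d) (Fin n → Fin d) ℂ

/-- The product state `ρ_0 ⊗ ⋯ ⊗ ρ_{n-1}` on `L(H)^{⊗ n}`. -/
def prodState {d n : ℕ} (ρ : Fin n → State d) : TensorOp d n :=
  Matrix.of fun x y => ∏ i, (ρ i).1 (x i) (y i)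

/-- The von Neumann entropy `H(ρ) = -Tr (ρ log ρ)`, to base `2`; the logarithm of a matrix is taken
in the functional calculus (a zero eigenvalue contributes `0`). -/
def entropy {d : ℕ} (ρ : Matrix (Fin d) (Fin d) ℂ) : ℝ :=
  -(ρ * cfc (Real.logb 2) ρ).trace.re

/-- `P` is a finitely supported probability distribution on the set `W` of states; these are the
distributions for which `∑ P(ρ) ρ` and `∑ P(ρ) H(ρ)` are plain sums, whatever the set `W`. -/
structure IsDistribution {d : ℕ} (W : Set (State d)) (P : State d →₀ ℝ) : Prop where
  nonneg : ∀ ρ, 0 ≤ P ρ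
  sum_eq_one : (P.sum fun _ p => p) = 1
  support_subset : (P.support : Set (State d)) ⊆ W

/-- The average state `∑ P(ρ) ρ`. -/
def avgState {d : ℕ} (P : State d →₀ ℝ) : Matrix (Fin d) (Fin d) ℂ :=
  P.sum fun ρ p => (p : ℂ) • ρ.1

/-- `I(P; W) = H(∑ P(ρ) ρ) - ∑ P(ρ) H(ρ)`. -/
def mutualInfo {d : ℕ} (P : State d →₀ ℝ) : ℝ :=
  entropy (avgState P) - P.sum fun ρ p => p * entropy ρ.1

/-- `C(W)`, the supremum of `I(P; W)` over the probability distributions `P` on `W`. -/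
def capacity {d : ℕ} (W : Set (State d)) : ℝ :=
  sSup {I : ℝ | ∃ P : State d →₀ ℝ, IsDistribution W P ∧ I = mutualInfo P}

/-- An `n`-block code `(f, D)` for the nonstationary channel `W_0, W_1, …`: a finite set of messages
inside the (countable) set of outcomes of an observable `D` on `L(H)^{⊗ n}`, and an encoding `f` of
the messages by words in `W_0 × ⋯ × W_{n-1}`. -/
structure BlockCode {d : ℕ} (W : ℕ → Set (State d)) (n : ℕ) where
  Outcome : Type
  countable_outcome : Countable Outcome
  messages : Finset Outcome
  encode : messages → (i : Fin n) → W i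
  observable : Outcome → TensorOp d n
  observable_pos : ∀ m, (observable m).PosSemidef
  observable_sum : HasSum observable 1

/-- The code word `f(m)`, as a product state. -/
def BlockCode.codeword {d : ℕ} {W : ℕ → Set (State d)} {n : ℕ} (c : BlockCode W n)
    (m : c.messages) : TensorOp d n :=
  prodState fun i => (c.encode m i : State d)

/-- The maximum error probability `max {1 - Tr (f(m) D_m) : m ∈ M}` (it is `0` without messages). -/
def BlockCode.error {d : ℕ} {W : ℕ → Set (State d)} {n : ℕ} (c : BlockCode W n) : ℝ :=
  ⨆ m : c.messages, (1 - (c.codeword m * c.observable m).trace.re)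

/-- The sizes `|M|` of the `(n, lam)`-codes. -/
def codeSizes {d : ℕ} (W : ℕ → Set (State d)) (n : ℕ) (lam : ℝ) : Set ℕ :=
  {k : ℕ | ∃ c : BlockCode W n, c.error ≤ lam ∧ c.messages.card = k}

/-- `N(n, lam)`, the maximal size of an `(n, lam)`-code; see `maxCodeSize_isGreatest`. -/
def maxCodeSize {d : ℕ} (W : ℕ → Set (State d)) (n : ℕ) (lam : ℝ) : ℕ :=
  sSup (codeSizes W n lam)

theorem norm_entry_le_trace {ι : Type*} [Fintype ι] {A : Matrix ι ι ℂ}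
    (hA : A.PosSemidef) (x y : ι) : ‖A x y‖ ≤ A.trace.re := by
  have hdiag : ∀ i, 0 ≤ (A i i).re ∧ (A i i).im = 0 := fun i => by
    have h := Complex.le_def.1 (hA.diag_nonneg (i := i))
    exact ⟨h.1, h.2.symm⟩
  have hle : ∀ i, (A i i).re ≤ A.trace.re := fun i => by
    rw [Matrix.trace, Complex.re_sum]
    exact Finset.single_le_sum (f := fun j => (A j j).re) (fun j _ => (hdiag j).1)
      (Finset.mem_univ i)
  have hdet := (hA.submatrix ![x, y]).det_nonneg
  have hyx : A y x = star (A x y) := (hA.isHermitian.apply y x).symm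
  rw [Matrix.det_fin_two] at hdet
  have hdet' := (Complex.le_def.1 hdet).1
  simp only [Matrix.submatrix_apply, Matrix.cons_val_zero, Matrix.cons_val_one, Complex.zero_re,
    Complex.sub_re, Complex.mul_re, hyx, (hdiag x).2, (hdiag y).2, Complex.star_def,
    Complex.conj_re, Complex.conj_im] at hdet'
  have hsq : ‖A x y‖ ^ 2 = (A x y).re * (A x y).re + (A x y).im * (A x y).im := by
    rw [Complex.sq_norm, Complex.normSq_apply]
  have hx := hdiag x
  have hy := hdiag y
  have htr : 0 ≤ A.trace.re := hx.1.trans (hle x)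
  refine abs_le_of_sq_le_sq' ?_ htr |>.2
  have := mul_le_mul (hle x) (hle y) hy.1 htr
  nlinarith

theorem codeSizes_bddAbove {d : ℕ} (W : ℕ → Set (State d)) (n : ℕ) {lam : ℝ} (h : lam < 1) :
    BddAbove (codeSizes W n lam) := by
  set N : ℝ := (Fintype.card (Fin n → Fin d) : ℝ) with hN
  obtain ⟨B, hB⟩ := exists_nat_ge (N ^ 2 * N / (1 - lam))
  refine ⟨B, ?_⟩
  rintro k ⟨c, hc, rfl⟩
  have hpos : 0 < 1 - lam := by linarith
  have hrho : ∀ m x y, ‖c.codeword m x y‖ ≤ 1 := fun m x y => by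
    simp only [BlockCode.codeword, prodState, Matrix.of_apply, norm_prod]
    refine Finset.prod_le_one (fun _ _ => norm_nonneg _) fun i _ => ?_
    have := norm_entry_le_trace (c.encode m i : State d).2.1 (x i) (y i)
    rwa [(c.encode m i : State d).2.2, Complex.one_re] at this
  have hone : ∀ m : c.messages,
      1 - lam ≤ N ^ 2 * (c.observable m).trace.re := fun m => by
    have h1 : 1 - (c.codeword m * c.observable m).trace.re ≤ lam :=
      (le_ciSup (f := fun m : c.messages => 1 - (c.codeword m * c.observable m).trace.re)
        (Set.finite_range _).bddAbove m).trans hc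
    have h2 : (c.codeword m * c.observable m).trace.re ≤ N ^ 2 * (c.observable m).trace.re := by
      refine (Complex.re_le_norm _).trans ?_
      calc ‖(c.codeword m * c.observable m).trace‖
          ≤ ∑ x, ∑ y, ‖c.codeword m x y * c.observable m y x‖ := by
            simp only [Matrix.trace, Matrix.diag_apply, Matrix.mul_apply]
            exact (norm_sum_le _ _).trans (Finset.sum_le_sum fun x _ => norm_sum_le _ _)
        _ ≤ ∑ _x : Fin n → Fin d, ∑ _y : Fin n → Fin d, (c.observable m).trace.re := by
            refine Finset.sum_le_sum fun x _ => Finset.sum_le_sum fun y _ => ?_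
            rw [norm_mul]
            have h3 := norm_entry_le_trace (c.observable_pos m) y x
            nlinarith [hrho m x y, norm_nonneg (c.codeword m x y),
              norm_nonneg (c.observable m y x)]
        _ = N ^ 2 * (c.observable m).trace.re := by
            simp only [Finset.sum_const, Finset.card_univ, nsmul_eq_mul]
            ring
    linarith
  have htr : HasSum (fun m => (c.observable m).trace.re) N := by
    have h1 := c.observable_sum.map
      (Complex.reAddGroupHom.comp (Matrix.traceAddMonoidHom (Fin n → Fin d) ℂ))
      (Complex.continuous_re.comp (continuous_id.matrix_trace))
    have h2 : Complex.reAddGroupHom.comp (Matrix.traceAddMonoidHom (Fin n → Fin d) ℂ) 1 = N := by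
      change (Matrix.trace (1 : TensorOp d n)).re = N
      rw [Matrix.trace_one, Complex.natCast_re]
    rw [h2] at h1
    exact h1
  have hsum : ∑ m ∈ c.messages, (c.observable m).trace.re ≤ N :=
    sum_le_hasSum _ (fun m _ => (Complex.le_def.1 (c.observable_pos m).trace_nonneg).1) htr
  have hfin : (c.messages.card : ℝ) * (1 - lam) ≤ N ^ 2 * N := by
    calc (c.messages.card : ℝ) * (1 - lam) = ∑ _m ∈ c.messages, (1 - lam) := by
          rw [Finset.sum_const, nsmul_eq_mul]
      _ ≤ ∑ m ∈ c.messages, N ^ 2 * (c.observable m).trace.re :=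
          Finset.sum_le_sum fun m hm => hone ⟨m, hm⟩
      _ = N ^ 2 * ∑ m ∈ c.messages, (c.observable m).trace.re := by rw [Finset.mul_sum]
      _ ≤ N ^ 2 * N := mul_le_mul_of_nonneg_left hsum (sq_nonneg _)
  exact_mod_cast ((le_div_iff₀ hpos).2 hfin).trans hB

/-- The maximum in the definition of `N(n, lam)` exists. -/
theorem maxCodeSize_isGreatest {d : ℕ} (W : ℕ → Set (State d)) (n : ℕ) {lam : ℝ} (h₀ : 0 ≤ lam)
    (h₁ : lam < 1) : IsGreatest (codeSizes W n lam) (maxCodeSize W n lam) := by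
  have hne : (codeSizes W n lam).Nonempty :=
    ⟨0, { Outcome := Unit
          countable_outcome := inferInstance
          messages := ∅
          encode := fun m => absurd m.2 (Finset.notMem_empty _)
          observable := fun _ => 1
          observable_pos := fun _ => Matrix.PosSemidef.one
          observable_sum := hasSum_unique (fun _ : Unit => (1 : TensorOp d n)) },
      by simpa [BlockCode.error] using h₀, rfl⟩
  have hb := codeSizes_bddAbove W n h₁
  exact ⟨Nat.sSup_mem hne hb, fun _ hk => le_csSup hb hk⟩

theorem entropy_eq_sum {d : ℕ} {ρ : Matrix (Fin d) (Fin d) ℂ} (hρ : ρ.IsHermitian) :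
    entropy ρ = ∑ i, Real.negMulLog (hρ.eigenvalues i) / Real.log 2 := by
  have h1 : ρ * cfc (Real.logb 2) ρ = cfc (fun x : ℝ => x * Real.logb 2 x) ρ := by
    have hfin : (spectrum ℝ ρ).Finite := by
      rw [hρ.spectrum_real_eq_range_eigenvalues]
      exact Set.finite_range _
    have h2 := cfc_mul (fun x : ℝ => x) (Real.logb 2) ρ (hfin.continuousOn _)
      (hfin.continuousOn _)
    have h3 : cfc (fun x : ℝ => x) ρ = ρ := cfc_id' ℝ ρ hρ
    exact (h2.trans (congrArg (· * cfc (Real.logb 2) ρ) h3)).symm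
  rw [entropy, h1, hρ.cfc_eq, Matrix.IsHermitian.cfc, Unitary.conjStarAlgAut_apply,
    Matrix.trace_mul_cycle, Unitary.coe_star_mul_self, one_mul, Matrix.trace_diagonal,
    Complex.re_sum, ← Finset.sum_neg_distrib]
  refine Finset.sum_congr rfl fun i _ => ?_
  simp only [Function.comp_apply, Complex.coe_algebraMap, Complex.ofReal_re, Real.negMulLog, Real.logb]
  ring

theorem avgState_posSemidef {d : ℕ} {W : Set (State d)} {P : State d →₀ ℝ}
    (hP : IsDistribution W P) : (avgState P).PosSemidef ∧ (avgState P).trace = 1 := by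
  constructor
  · refine Matrix.posSemidef_sum _ fun ρ _ => ρ.2.1.smul ?_
    exact_mod_cast hP.nonneg ρ
  · rw [avgState, Finsupp.sum, Matrix.trace_sum]
    have ht : ∀ ρ : State d, ρ.1.trace = 1 := fun ρ => ρ.2.2
    simp only [Matrix.trace_smul, ht]
    have := hP.sum_eq_one
    rw [Finsupp.sum] at this
    simp only [smul_eq_mul, mul_one]
    exact_mod_cast this

theorem entropy_nonneg {d : ℕ} (ρ : State d) : 0 ≤ entropy ρ.1 := by
  rw [entropy_eq_sum ρ.2.1.isHermitian]
  have hs := ρ.2.1.isHermitian.trace_eq_sum_eigenvalues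
  replace hs := ρ.2.2.symm.trans hs
  have hs' : ∑ i, ρ.2.1.isHermitian.eigenvalues i = 1 := by
    simpa using (congrArg Complex.re hs).symm
  refine Finset.sum_nonneg fun i _ => div_nonneg (Real.negMulLog_nonneg
    (ρ.2.1.eigenvalues_nonneg i) ?_) (Real.log_nonneg one_le_two)
  rw [← hs']
  exact Finset.single_le_sum (fun j _ => ρ.2.1.eigenvalues_nonneg j) (Finset.mem_univ i)

/-- The supremum in the definition of `C(W)` exists. -/
theorem capacity_isLUB {d : ℕ} {W : Set (State d)} (hW : W.Nonempty) :
    IsLUB {I : ℝ | ∃ P : State d →₀ ℝ, IsDistribution W P ∧ I = mutualInfo P} (capacity W) := by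
  obtain ⟨ρ₀, hρ₀⟩ := hW
  refine isLUB_csSup ⟨_, Finsupp.single ρ₀ 1, ⟨fun ρ => ?_, by simp, fun ρ hρ => ?_⟩, rfl⟩
    ⟨d / Real.log 2, ?_⟩
  · classical
    rw [Finsupp.single_apply]
    split_ifs <;> norm_num
  · have := Finsupp.support_single_subset hρ
    rw [Finset.mem_singleton] at this
    exact this ▸ hρ₀
  · rintro _ ⟨P, hP, rfl⟩
    have h1 : 0 ≤ P.sum fun ρ p => p * entropy ρ.1 :=
      Finset.sum_nonneg fun ρ _ => mul_nonneg (hP.nonneg ρ) (entropy_nonneg ρ)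
    have hpsd := (avgState_posSemidef hP).1
    have h2 : entropy (avgState P) ≤ d / Real.log 2 := by
      rw [entropy_eq_sum hpsd.isHermitian, ← Finset.sum_div]
      refine div_le_div_of_nonneg_right ?_ (Real.log_nonneg one_le_two)
      calc ∑ i, Real.negMulLog (hpsd.isHermitian.eigenvalues i) ≤ ∑ _i : Fin d, (1 : ℝ) := by
            refine Finset.sum_le_sum fun i _ => ?_
            have h3 := hpsd.eigenvalues_nonneg i
            rcases h3.eq_or_lt with h4 | h4
            · rw [← h4]; simp
            · have h5 := Real.one_sub_inv_le_log_of_pos h4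
              have h6 := mul_le_mul_of_nonneg_left h5 h3
              rw [mul_sub, mul_one, mul_inv_cancel₀ h4.ne'] at h6
              rw [Real.negMulLog]
              linarith
        _ = d := by simp
    rw [mutualInfo]
    linarith

end

end QChannel

namespace QChannel

noncomputable section

open Matrix

/-! ### Spectral calculus by eigenvalue sums, and Klein's inequality. -/

section Spectral

variable {ι : Type*} [Fintype ι]

/-! Each `W i` has an approximate divergence centre: an operator `B i` from which every state of `W
i` has relative entropy at most `C(W i)`, up to a small error (`exists_capacity_center`). It is a
nearly optimal average state plus a small multiple of the identity. If some state were farther away,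
moving a little mass onto it would push the mutual information above the capacity. Klein's
inequality and operator monotonicity of the logarithm make this quantitative.

Now test a code word `ρ` against the product `B` of the centres. By Chernoff bounds, the eigenvalues
of `ρ` are typically at most `S` and the eigenvalues of `B` seen by `ρ` are typically at least `Q`,
where `log (S / Q)` is the sum of the relative entropies plus a small multiple of `n`. The operators
need not commute, so the two truncations are made separately and combined by pinching
(`trace_mul_effect_le`). Hence, up to exponentially small terms, a decoding operator that accepts
`ρ` with probability at least `1 - lam` has weight of order `Q / S` under `B`. The decoding
operators sum to at most the identity, so their total weight is at most `Tr B`, which is nearly one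
on the exponential scale; this bounds the number of messages.

The shift by the identity keeps the spectrum of each `B i` in a range depending only on `d` and `ε`,
so the Chernoff bounds, and with them `n₀`, are uniform over all channels. -/

theorem diag_conj_re_nonneg {M : Matrix ι ι ℂ} (hM : M.PosSemidef) (U : Matrix ι ι ℂ) (i : ι) :
    0 ≤ ((Uᴴ * M * U) i i).re :=
  (Complex.le_def.1 (hM.conjTranspose_mul_mul_same U).diag_nonneg).1

variable [DecidableEq ι]

/-- The matrix `U diag(a) Uᴴ`. -/
def conjDiag (U : Matrix ι ι ℂ) (a : ι → ℝ) : Matrix ι ι ℂ :=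
  U * diagonal (fun i => (a i : ℂ)) * Uᴴ

/-- A single eigenbasis serves `A` and all functions of `A`, so later traces become sums over
eigenvalues. -/
theorem exists_conjDiag {A : Matrix ι ι ℂ} (hA : A.IsHermitian) :
    ∃ U : Matrix ι ι ℂ, Uᴴ * U = 1 ∧ U * Uᴴ = 1 ∧ A = conjDiag U hA.eigenvalues ∧
      ∀ f : ℝ → ℝ, cfc f A = conjDiag U (f ∘ hA.eigenvalues) := by
  refine ⟨hA.eigenvectorUnitary, Unitary.coe_star_mul_self _, Unitary.coe_mul_star_self _, ?_, ?_⟩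
  · conv_lhs => rw [hA.spectral_theorem, Unitary.conjStarAlgAut_apply]
    rfl
  · intro f
    rw [hA.cfc_eq, Matrix.IsHermitian.cfc, Unitary.conjStarAlgAut_apply]
    rfl

theorem trace_mul_conjDiag (M U : Matrix ι ι ℂ) (a : ι → ℝ) :
    (M * conjDiag U a).trace.re = ∑ i, a i * ((Uᴴ * M * U) i i).re := by
  have h : (M * conjDiag U a).trace =
      (Uᴴ * M * U * diagonal (fun i => (a i : ℂ))).trace := by
    rw [conjDiag, ← Matrix.mul_assoc, Matrix.trace_mul_comm, ← Matrix.mul_assoc,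
      ← Matrix.mul_assoc]
  rw [h, Matrix.trace, Complex.re_sum]
  refine Finset.sum_congr rfl fun i _ => ?_
  rw [Matrix.diag_apply, Matrix.mul_diagonal, Complex.re_mul_ofReal, mul_comm]

theorem posSemidef_conjDiag (U : Matrix ι ι ℂ) {a : ι → ℝ} (ha : ∀ i, 0 ≤ a i) :
    (conjDiag U a).PosSemidef :=
  (Matrix.PosSemidef.diagonal fun i => by
    simpa using ha i).mul_mul_conjTranspose_same U

theorem conjDiag_add (U : Matrix ι ι ℂ) (a b : ι → ℝ) :
    conjDiag U a + conjDiag U b = conjDiag U (a + b) := by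
  rw [conjDiag, conjDiag, conjDiag, ← Matrix.add_mul, ← Matrix.mul_add, Matrix.diagonal_add]
  simp

theorem conjDiag_mul {U : Matrix ι ι ℂ} (hU : Uᴴ * U = 1) (a b : ι → ℝ) :
    conjDiag U a * conjDiag U b = conjDiag U (a * b) := by
  have h : conjDiag U a * conjDiag U b =
      U * diagonal (fun i => (a i : ℂ)) * (Uᴴ * U) * diagonal (fun i => (b i : ℂ)) * Uᴴ := by
    simp only [conjDiag, Matrix.mul_assoc]
  rw [h, hU, Matrix.mul_one, Matrix.mul_assoc U, Matrix.diagonal_mul_diagonal, conjDiag]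
  simp

theorem conjDiag_one {U : Matrix ι ι ℂ} (hU : U * Uᴴ = 1) : conjDiag U 1 = 1 := by
  rw [conjDiag]
  simp [hU]

theorem trace_conjDiag {U : Matrix ι ι ℂ} (hU : Uᴴ * U = 1) (a : ι → ℝ) :
    (conjDiag U a).trace.re = ∑ i, a i := by
  have := trace_mul_conjDiag 1 U a
  rw [Matrix.one_mul] at this
  rw [this]
  simp [hU]

theorem conjDiag_diag_re {U : Matrix ι ι ℂ} (hU : Uᴴ * U = 1) (a : ι → ℝ) (i : ι) :
    ((Uᴴ * conjDiag U a * U) i i).re = a i := by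
  have h : Uᴴ * conjDiag U a * U = (Uᴴ * U) * diagonal (fun i => (a i : ℂ)) * (Uᴴ * U) := by
    simp only [conjDiag, Matrix.mul_assoc]
  rw [h, hU]
  simp

theorem trace_mul_nonneg {A M : Matrix ι ι ℂ} (hA : A.PosSemidef) (hM : M.PosSemidef) :
    0 ≤ (A * M).trace.re := by
  obtain ⟨U, -, -, hU, -⟩ := exists_conjDiag hA.isHermitian
  rw [hU, Matrix.trace_mul_comm, trace_mul_conjDiag]
  exact Finset.sum_nonneg fun i _ =>
    mul_nonneg (hA.eigenvalues_nonneg i) (diag_conj_re_nonneg hM U i)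

theorem trace_mul_mono {A M N : Matrix ι ι ℂ} (hA : A.PosSemidef) (h : (N - M).PosSemidef) :
    (A * M).trace.re ≤ (A * N).trace.re := by
  have := trace_mul_nonneg hA h
  rw [Matrix.mul_sub, Matrix.trace_sub, Complex.sub_re] at this
  linarith

theorem diag_conj_conjDiag_re (U V : Matrix ι ι ℂ) (a : ι → ℝ) (j : ι) :
    ((Vᴴ * conjDiag U a * V) j j).re = ∑ i, a i * Complex.normSq ((Uᴴ * V) i j) := by
  have h : Vᴴ * conjDiag U a * V = (Uᴴ * V)ᴴ * diagonal (fun i => (a i : ℂ)) * (Uᴴ * V) := by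
    simp only [conjDiag, Matrix.mul_assoc, Matrix.conjTranspose_mul,
      Matrix.conjTranspose_conjTranspose]
  rw [h, Matrix.mul_apply, Complex.re_sum]
  refine Finset.sum_congr rfl fun i _ => ?_
  rw [Matrix.mul_diagonal, Matrix.conjTranspose_apply, mul_right_comm, Complex.star_def,
    mul_comm (starRingEnd ℂ _), Complex.mul_conj, ← Complex.ofReal_mul, Complex.ofReal_re, mul_comm]

theorem sum_normSq_col {M : Matrix ι ι ℂ} (h : Mᴴ * M = 1) (j : ι) :
    ∑ i, Complex.normSq (M i j) = 1 := by
  have := congrArg Complex.re (congrFun (congrFun h j) j)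
  rw [Matrix.mul_apply, Matrix.one_apply_eq, Complex.re_sum, Complex.one_re] at this
  rw [← this]
  refine Finset.sum_congr rfl fun i _ => ?_
  rw [Matrix.conjTranspose_apply, Complex.star_def, mul_comm, Complex.mul_conj, Complex.ofReal_re]

theorem sum_normSq_row {M : Matrix ι ι ℂ} (h : M * Mᴴ = 1) (i : ι) :
    ∑ j, Complex.normSq (M i j) = 1 := by
  have := sum_normSq_col (M := Mᴴ) (by simpa using h) i
  simpa [Complex.normSq_conj] using this

/-- This is `log x ≤ x - 1` at `x = b / a`, the scalar case of Klein's inequality. The value `log 0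
= 0` covers `a = 0`. -/
theorem mul_log_le_mul_log_sub_add {a b : ℝ} (ha : 0 ≤ a) (hb : 0 < b) :
    a * Real.log b ≤ a * Real.log a - a + b := by
  rcases ha.eq_or_lt with rfl | ha
  · simpa using hb.le
  · have h := Real.log_le_sub_one_of_pos (div_pos hb ha)
    rw [Real.log_div hb.ne' ha.ne'] at h
    have h2 := mul_le_mul_of_nonneg_left h ha.le
    have h3 : a * (b / a - 1) = b - a := by field_simp
    rw [h3] at h2
    linarith

/-- **Klein's inequality**. -/
theorem klein_inequality {A B : Matrix ι ι ℂ} (hA : A.PosSemidef) (hB : B.PosDef) :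
    (A * cfc Real.log B).trace.re ≤
      (A * cfc Real.log A).trace.re - A.trace.re + B.trace.re := by
  obtain ⟨U, hU1, hU2, hAU, hAf⟩ := exists_conjDiag hA.isHermitian
  obtain ⟨V, hV1, hV2, hBV, hBf⟩ := exists_conjDiag hB.isHermitian
  set a := hA.isHermitian.eigenvalues with ha
  set b := hB.isHermitian.eigenvalues with hb
  -- The squared overlaps of the two eigenbases form a doubly stochastic matrix. With these weights
  -- all four traces become double sums, and the scalar inequality applies term by term.
  have hw1 : (Uᴴ * V)ᴴ * (Uᴴ * V) = 1 := by
    rw [Matrix.conjTranspose_mul, Matrix.conjTranspose_conjTranspose, Matrix.mul_assoc,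
      ← Matrix.mul_assoc U, hU2, Matrix.one_mul, hV1]
  have hw2 : (Uᴴ * V) * (Uᴴ * V)ᴴ = 1 := by
    rw [Matrix.conjTranspose_mul, Matrix.conjTranspose_conjTranspose, Matrix.mul_assoc,
      ← Matrix.mul_assoc V, hV2, Matrix.one_mul, hU1]
  have h1 : (A * cfc Real.log B).trace.re =
      ∑ j, ∑ i, Complex.normSq ((Uᴴ * V) i j) * (a i * Real.log (b j)) := by
    rw [hBf, trace_mul_conjDiag]
    refine Finset.sum_congr rfl fun j _ => ?_
    rw [hAU, diag_conj_conjDiag_re, Finset.mul_sum]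
    exact Finset.sum_congr rfl fun i _ => by simp only [Function.comp_apply]; ring
  have h2 : (A * cfc Real.log A).trace.re =
      ∑ j, ∑ i, Complex.normSq ((Uᴴ * V) i j) * (a i * Real.log (a i)) := by
    rw [hAf, trace_mul_conjDiag, Finset.sum_comm]
    refine Finset.sum_congr rfl fun i _ => ?_
    rw [← Finset.sum_mul, sum_normSq_row hw2, hAU, conjDiag_diag_re hU1, one_mul]
    exact mul_comm _ _
  have h3 : A.trace.re = ∑ j, ∑ i, Complex.normSq ((Uᴴ * V) i j) * a i := by
    rw [Finset.sum_comm, hAU, trace_conjDiag hU1]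
    refine Finset.sum_congr rfl fun i _ => ?_
    rw [← Finset.sum_mul, sum_normSq_row hw2, one_mul]
  have h4 : B.trace.re = ∑ j, ∑ i, Complex.normSq ((Uᴴ * V) i j) * b j := by
    rw [hBV, trace_conjDiag hV1]
    refine Finset.sum_congr rfl fun i _ => ?_
    rw [← Finset.sum_mul, sum_normSq_col hw1, one_mul]
  rw [h1, h2, h3, h4, ← Finset.sum_sub_distrib, ← Finset.sum_add_distrib]
  refine Finset.sum_le_sum fun j _ => ?_
  rw [← Finset.sum_sub_distrib, ← Finset.sum_add_distrib]
  refine Finset.sum_le_sum fun i _ => ?_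
  rw [← mul_sub, ← mul_add]
  exact mul_le_mul_of_nonneg_left
    (mul_log_le_mul_log_sub_add (hA.eigenvalues_nonneg i) (hB.eigenvalues_pos j))
    (Complex.normSq_nonneg _)

/-- A zero eigenvalue has weight zero on both sides and the logarithm increases on the others. This
allows a singular state to be replaced by a positive definite operator, as monotonicity of the
operator logarithm requires. -/
theorem trace_mul_log_le_add_smul_one {A : Matrix ι ι ℂ} (hA : A.PosSemidef) {s : ℝ}
    (hs : 0 < s) :
    (A * cfc Real.log A).trace.re ≤ (A * cfc Real.log (A + s • (1 : Matrix ι ι ℂ))).trace.re := by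
  have hsa : IsSelfAdjoint A := hA.isHermitian
  have hcont : ∀ f : ℝ → ℝ, ContinuousOn f (spectrum ℝ A) :=
    fun f => Matrix.finite_real_spectrum.continuousOn f
  have h1 : A + s • (1 : Matrix ι ι ℂ) = cfc (fun x : ℝ => x + s) A := by
    rw [cfc_add_const s (fun x : ℝ => x) A (hcont _) hsa, cfc_id' ℝ A hsa,
      Algebra.algebraMap_eq_smul_one]
  have h2 : cfc Real.log (A + s • (1 : Matrix ι ι ℂ)) = cfc (fun x : ℝ => Real.log (x + s)) A := by
    rw [h1, cfc_comp' Real.log (fun x : ℝ => x + s) A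
      (((Matrix.finite_real_spectrum (A := A)).image _).continuousOn _) (hcont _) hsa]
  obtain ⟨U, hU1, hU2, hAU, hAf⟩ := exists_conjDiag hA.isHermitian
  rw [h2, hAf, hAf, trace_mul_conjDiag, trace_mul_conjDiag]
  refine Finset.sum_le_sum fun i _ => ?_
  have h3 : ((Uᴴ * A * U) i i).re = hA.isHermitian.eigenvalues i := by
    conv_lhs => rw [hAU]
    exact conjDiag_diag_re hU1 _ i
  rw [h3]
  have h4 := hA.eigenvalues_nonneg i
  rcases h4.eq_or_lt with h5 | h5
  · rw [← h5]; simp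
  · exact mul_le_mul_of_nonneg_right (Real.log_le_log h5 (by linarith)) h4

theorem posSemidef_one_sub {A : Matrix ι ι ℂ} (hA : A.PosSemidef) (htr : A.trace.re = 1) :
    (1 - A).PosSemidef := by
  obtain ⟨U, hU1, hU2, hAU, -⟩ := exists_conjDiag hA.isHermitian
  have h0 := trace_conjDiag hU1 hA.isHermitian.eigenvalues
  rw [← hAU, htr] at h0
  have h1 : 1 - A = conjDiag U (1 - hA.isHermitian.eigenvalues) :=
    sub_eq_iff_eq_add.2 (((congrArg (conjDiag U (1 - hA.isHermitian.eigenvalues) + ·) hAU).trans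
      (by rw [conjDiag_add, sub_add_cancel, conjDiag_one hU2])).symm)
  rw [h1]
  refine posSemidef_conjDiag U fun i => ?_
  rw [Pi.sub_apply, Pi.one_apply, sub_nonneg, h0]
  exact Finset.single_le_sum (fun j _ => hA.eigenvalues_nonneg j) (Finset.mem_univ i)

end Spectral

/-! ### Operator monotonicity of the logarithm. -/

section LogMonotone

open scoped MatrixOrder Matrix.Norms.L2Operator

variable {ι : Type*} [Fintype ι] [DecidableEq ι]

/-- The logarithm is operator monotone on positive definite matrices. -/
theorem posSemidef_log_sub_log {A B : Matrix ι ι ℂ} (hA : A.PosDef) (hAB : (B - A).PosSemidef) :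
    (cfc Real.log B - cfc Real.log A).PosSemidef :=
  Matrix.le_iff.1 (CFC.log_le_log (a := A) (b := B) (Matrix.le_iff.2 hAB)
    (Matrix.isStrictlyPositive_iff_posDef.2 hA))

end LogMonotone

/-! ### The approximate divergence centre of a set of states. -/

section Center

variable {d : ℕ}

theorem entropy_mul_log_two {A : Matrix (Fin d) (Fin d) ℂ} (hA : A.IsHermitian) :
    entropy A * Real.log 2 = -(A * cfc Real.log A).trace.re := by
  obtain ⟨U, hU1, hU2, hAU, hAf⟩ := exists_conjDiag hA
  rw [entropy, hAf, hAf, trace_mul_conjDiag, trace_mul_conjDiag, neg_mul, Finset.sum_mul]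
  congr 1
  refine Finset.sum_congr rfl fun i _ => ?_
  have h2 : Real.log 2 ≠ 0 := (Real.log_pos one_lt_two).ne'
  simp only [Function.comp_apply, Real.logb]
  field_simp

theorem State.trace_re (ρ : State d) : ρ.1.trace.re = 1 := by
  rw [ρ.2.2, Complex.one_re]

/-- The distribution `(1 - t) P + t δ_ρ`. -/
def mix (P : State d →₀ ℝ) (t : ℝ) (ρ : State d) : State d →₀ ℝ :=
  (1 - t) • P + Finsupp.single ρ t

/-- Values in a module let one formula serve the total mass, the average state and the average
entropy. -/
theorem mix_sum {M : Type*} [AddCommGroup M] [Module ℝ M] (P : State d →₀ ℝ) (t : ℝ) (ρ : State d)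
    (g : State d → M) :
    ((mix P t ρ).sum fun ω p => p • g ω) = (1 - t) • (P.sum fun ω p => p • g ω) + t • g ρ := by
  rw [mix, Finsupp.sum_add_index' (h := fun ω p => p • g ω) (fun _ => zero_smul ℝ _) (fun _ _ _ => add_smul _ _ _),
    Finsupp.sum_smul_index (h := fun ω p => p • g ω) (fun _ => zero_smul ℝ _), Finsupp.sum_single_index (h := fun ω p => p • g ω) (zero_smul ℝ _),
    Finsupp.smul_sum]
  simp only [mul_smul]

theorem IsDistribution.mix {W : Set (State d)} {P : State d →₀ ℝ} (hP : IsDistribution W P)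
    {t : ℝ} (ht0 : 0 ≤ t) (ht1 : t ≤ 1) {ρ : State d} (hρ : ρ ∈ W) :
    IsDistribution W (mix P t ρ) where
  nonneg ω := by
    classical
    rw [QChannel.mix, Finsupp.add_apply, Finsupp.smul_apply, Finsupp.single_apply, smul_eq_mul]
    have := mul_nonneg (sub_nonneg.2 ht1) (hP.nonneg ω)
    split_ifs <;> linarith
  sum_eq_one := by
    have := mix_sum P t ρ (fun _ => (1 : ℝ))
    simp only [smul_eq_mul, mul_one] at this
    rw [this, hP.sum_eq_one]
    ring
  support_subset := by
    classical
    intro ω hω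
    rcases Finset.mem_union.1 (Finsupp.support_add hω) with h | h
    · exact hP.support_subset (Finsupp.support_smul h)
    · rw [Finset.mem_singleton.1 (Finsupp.support_single_subset h)]
      exact hρ

theorem avgState_mix (P : State d →₀ ℝ) (t : ℝ) (ρ : State d) :
    avgState (mix P t ρ) = (1 - t) • avgState P + t • ρ.1 := by
  have h := mix_sum P t ρ (fun ω => ω.1)
  have h2 : ∀ Q : State d →₀ ℝ, avgState Q = Q.sum fun ω p => p • ω.1 := fun Q => by
    simp only [avgState, Complex.coe_smul]
  rw [h2, h2, h]

theorem capacity_nonneg {W : Set (State d)} (hW : W.Nonempty) : 0 ≤ capacity W := by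
  obtain ⟨ρ, hρ⟩ := hW
  refine (capacity_isLUB ⟨ρ, hρ⟩).1 ⟨Finsupp.single ρ 1, ⟨fun ω => ?_, by simp, fun ω hω => ?_⟩, ?_⟩
  · classical
    rw [Finsupp.single_apply]
    split_ifs <;> norm_num
  · rw [Finset.mem_singleton.1 (Finsupp.support_single_subset hω)]
    exact hρ
  · simp [mutualInfo, avgState]

/-- First-order optimality of a nearly optimal `P` under perturbation towards `δ_ρ`. The supremum
need not be attained, so the argument uses a finite step `t` rather than a derivative; `B` is the
same for all `ρ`. -/
theorem exists_capacity_center {W : Set (State d)} (hW : W.Nonempty) {t : ℝ} (ht0 : 0 < t)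
    (ht1 : t ≤ 1) :
    ∃ B : Matrix (Fin d) (Fin d) ℂ, (B - t • (1 : Matrix (Fin d) (Fin d) ℂ)).PosSemidef ∧
      B.trace.re ≤ 1 + 2 * t * d ∧
      ∀ ρ ∈ W, (ρ.1 * cfc Real.log ρ.1).trace.re - (ρ.1 * cfc Real.log B).trace.re ≤
        capacity W * Real.log 2 + t * (1 + d) := by
  -- The gap `t ^ 2` still leaves an error of order `t` after division by the step `t`.
  obtain ⟨_, ⟨P, hP, rfl⟩, hPC⟩ := ((capacity_isLUB hW).exists_between
    (sub_lt_self (capacity W) (pow_pos ht0 2)))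
  have hσ := avgState_posSemidef hP
  set σ := avgState P with hσdef
  have hσtr : σ.trace.re = 1 := by rw [hσ.2, Complex.one_re]
  have hone : (1 : Matrix (Fin d) (Fin d) ℂ).PosSemidef := Matrix.PosSemidef.one
  -- The part `t ^ 2` regularizes the perturbed state; the part `t` makes `B` dominate that
  -- regularization for every `ρ`.
  refine ⟨σ + (t + t ^ 2) • (1 : Matrix (Fin d) (Fin d) ℂ), ?_, ?_, fun ρ hρ => ?_⟩
  · rw [add_smul, add_sub_assoc, add_sub_cancel_left]
    exact hσ.1.add (hone.smul (sq_nonneg t))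
  · rw [Matrix.trace_add, Matrix.trace_smul, Complex.add_re, hσtr, Complex.smul_re,
      Matrix.trace_one, Fintype.card_fin, Complex.natCast_re, smul_eq_mul]
    have hd : (0 : ℝ) ≤ d := Nat.cast_nonneg d
    nlinarith [mul_nonneg (mul_nonneg ht0.le (sub_nonneg.2 ht1)) hd]
  · have hPt := hP.mix ht0.le ht1 hρ
    have hσt := (avgState_posSemidef hPt).1
    have hI : mutualInfo (mix P t ρ) ≤ capacity W := (capacity_isLUB hW).1 ⟨_, hPt, rfl⟩
    have hE := mix_sum P t ρ (fun ω => entropy ω.1)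
    simp only [smul_eq_mul] at hE
    rw [mutualInfo, hE] at hI
    rw [mutualInfo] at hPC
    have hσt_eq := avgState_mix P t ρ
    rw [← hσdef] at hσt_eq hPC
    set σt := avgState (mix P t ρ) with hσtdef
    set E := P.sum fun ω p => p * entropy ω.1 with hEdef
    have hpos : (t ^ 2 • (1 : Matrix (Fin d) (Fin d) ℂ)).PosDef :=
      Matrix.PosDef.one.smul (pow_pos ht0 2)
    have hS : (σt + t ^ 2 • (1 : Matrix (Fin d) (Fin d) ℂ)).PosDef :=
      hpos.posSemidef_add hσt
    have h1 := trace_mul_log_le_add_smul_one hσt (pow_pos ht0 2)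
    have h2 := klein_inequality hσ.1 hS
    have htrS : (σt + t ^ 2 • (1 : Matrix (Fin d) (Fin d) ℂ)).trace.re = 1 + t ^ 2 * d := by
      rw [Matrix.trace_add, Matrix.trace_smul, Complex.add_re, (avgState_posSemidef hPt).2,
        Complex.smul_re, Matrix.trace_one, Fintype.card_fin, Complex.natCast_re, smul_eq_mul,
        Complex.one_re]
    rw [htrS, hσtr] at h2
    have hBS : ((σ + (t + t ^ 2) • (1 : Matrix (Fin d) (Fin d) ℂ)) -
        (σt + t ^ 2 • (1 : Matrix (Fin d) (Fin d) ℂ))).PosSemidef := by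
      have h3 : ((σ + (t + t ^ 2) • (1 : Matrix (Fin d) (Fin d) ℂ)) -
        (σt + t ^ 2 • (1 : Matrix (Fin d) (Fin d) ℂ))) = t • σ + t • (1 - ρ.1) := by
        rw [hσt_eq]
        module
      rw [h3]
      exact (hσ.1.smul ht0.le).add ((posSemidef_one_sub ρ.2.1 ρ.trace_re).smul ht0.le)
    -- This replaces the logarithm of the `ρ`-dependent regularized state by that of the fixed `B`.
    have h4 := trace_mul_mono ρ.2.1 (posSemidef_log_sub_log hS hBS)
    set S := cfc Real.log (σt + t ^ 2 • (1 : Matrix (Fin d) (Fin d) ℂ)) with hSdef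
    have h5 : (σt * S).trace.re = (1 - t) * (σ * S).trace.re + t * (ρ.1 * S).trace.re := by
      rw [hσt_eq, Matrix.add_mul, Matrix.smul_mul, Matrix.smul_mul, Matrix.trace_add,
        Matrix.trace_smul, Matrix.trace_smul, Complex.add_re, Complex.smul_re, Complex.smul_re,
        smul_eq_mul, smul_eq_mul]
    have e1 := entropy_mul_log_two hσt.isHermitian
    have e2 := entropy_mul_log_two hσ.1.isHermitian
    have e3 := entropy_mul_log_two ρ.2.1.isHermitian
    have hl0 : 0 < Real.log 2 := Real.log_pos one_lt_two
    have hl1 : Real.log 2 ≤ 1 := by linarith [Real.log_le_sub_one_of_pos (zero_lt_two (α := ℝ))]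
    have hd : (0 : ℝ) ≤ d := Nat.cast_nonneg d
    have a1 := mul_le_mul_of_nonneg_right hI hl0.le
    have a2 := mul_le_mul_of_nonneg_right hPC.1.le hl0.le
    have a3 := mul_le_mul_of_nonneg_left a2 (sub_nonneg.2 ht1)
    have a4 := mul_le_mul_of_nonneg_left h2 (sub_nonneg.2 ht1)
    -- The entropy of the perturbed state is at least `-Tr (σt * S)`, which is linear in `σt`;
    -- Klein's inequality bounds its `σ` part by the entropy of `σ`. Comparing both mutual
    -- informations with the capacity leaves `t` times the relative entropy.
    have key : t * ((ρ.1 * cfc Real.log ρ.1).trace.re - (ρ.1 * S).trace.re) ≤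
        t * (capacity W * Real.log 2 + t * (1 + d)) := by
      have b1 : (1 - t) * (t ^ 2 * d) ≤ t ^ 2 * d :=
        mul_le_of_le_one_left (by positivity) (by linarith)
      have b2 : (1 - t) * (t ^ 2 * Real.log 2) ≤ t ^ 2 :=
        (mul_le_of_le_one_left (by positivity) (by linarith)).trans
          (mul_le_of_le_one_right (by positivity) hl1)
      have e2' : (1 - t) * (entropy σ * Real.log 2) = (1 - t) * -(σ * cfc Real.log σ).trace.re := by
        rw [e2]
      have e3' : t * (entropy ρ.1 * Real.log 2) = t * -(ρ.1 * cfc Real.log ρ.1).trace.re := by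
        rw [e3]
      linarith
    have := le_of_mul_le_mul_left key ht0
    linarith

end Center

/-! ### A one-shot bound for non-commuting operators. -/

section Test

variable {ι : Type*} [Fintype ι] [DecidableEq ι]

theorem conjTranspose_conjDiag (U : Matrix ι ι ℂ) (a : ι → ℝ) :
    (conjDiag U a)ᴴ = conjDiag U a := by
  rw [conjDiag, Matrix.conjTranspose_mul, Matrix.conjTranspose_mul,
    Matrix.conjTranspose_conjTranspose, Matrix.diagonal_conjTranspose, Matrix.mul_assoc]
  congr 3
  ext i
  simp

/-- Pinching: `D ≤ 2 Π D Π + 2 (1 - Π) D (1 - Π)` for Hermitian `Π`. -/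
theorem posSemidef_pinching {D Q : Matrix ι ι ℂ} (hD : D.PosSemidef) (hQ : Qᴴ = Q) :
    ((2 : ℝ) • (Q * D * Q) + (2 : ℝ) • ((1 - Q) * D * (1 - Q)) - D).PosSemidef := by
  have h := hD.mul_mul_conjTranspose_same (Q - (1 - Q))
  have h1 : (Q - (1 - Q))ᴴ = Q - (1 - Q) := by
    simp [hQ]
  rw [h1] at h
  have h2 : (2 : ℝ) • (Q * D * Q) + (2 : ℝ) • ((1 - Q) * D * (1 - Q)) - D =
      (Q - (1 - Q)) * D * (Q - (1 - Q)) := by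
    rw [two_smul, two_smul]
    noncomm_ring
  rwa [h2]

/-- A one-shot bound for the probability that an effect `D` accepts the operator `A`, in terms of
the spectral tails of `A` and of `B`, and of the probability that `D` accepts `B`. -/
theorem trace_mul_effect_le {U V D : Matrix ι ι ℂ} (hU1 : Uᴴ * U = 1) (hU2 : U * Uᴴ = 1)
    (hV1 : Vᴴ * V = 1) (hV2 : V * Vᴴ = 1) {p q : ι → ℝ} (hp : ∀ x, 0 ≤ p x) (hq : ∀ x, 0 ≤ q x)
    (hD : D.PosSemidef)
    (hD1 : ∀ X : Matrix ι ι ℂ, X.PosSemidef → (X * D).trace.re ≤ X.trace.re)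
    {S Q : ℝ} (hS : 0 < S) (hQ : 0 < Q) :
    (conjDiag U p * D).trace.re ≤ ∑ x with S < p x, p x +
      2 * ∑ y with q y < Q, ((Vᴴ * conjDiag U p * V) y y).re +
      2 * (S / Q) * (conjDiag V q * D).trace.re := by
  -- Truncate `A` above `S` in its own eigenbasis, and let `T` below project onto the eigenvectors
  -- of `B` with eigenvalue at least `Q`.
  set p₁ : ι → ℝ := fun x => if S < p x then 0 else p x with hp₁
  set p₂ : ι → ℝ := fun x => if S < p x then p x else 0 with hp₂
  have hp12 : p₁ + p₂ = p := by
    ext x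
    simp only [hp₁, hp₂, Pi.add_apply]
    split_ifs <;> simp
  set c : ι → ℝ := fun y => if q y < Q then 0 else 1 with hc
  have hc' : ∀ y, (1 - c) y = if q y < Q then 1 else 0 := fun y => by
    simp only [hc, Pi.sub_apply, Pi.one_apply]
    split_ifs <;> simp
  set T := conjDiag V c with hT
  have hT1 : 1 - T = conjDiag V (1 - c) := by
    rw [sub_eq_iff_eq_add, conjDiag_add, sub_add_cancel, conjDiag_one hV2]
  have hp₁0 : ∀ x, 0 ≤ p₁ x := fun x => by simp only [hp₁]; split_ifs; exacts [le_rfl, hp x]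
  have hp₂0 : ∀ x, 0 ≤ p₂ x := fun x => by simp only [hp₂]; split_ifs; exacts [hp x, le_rfl]
  have hA₁ := posSemidef_conjDiag U hp₁0
  have hA₂ := posSemidef_conjDiag U hp₂0
  have hA := posSemidef_conjDiag U hp
  have hsplit : conjDiag U p = conjDiag U p₁ + conjDiag U p₂ := by rw [conjDiag_add, hp12]
  have h1 : (conjDiag U p * D).trace.re =
      (conjDiag U p₁ * D).trace.re + (conjDiag U p₂ * D).trace.re := by
    rw [hsplit, Matrix.add_mul, Matrix.trace_add, Complex.add_re]
  have h2 : (conjDiag U p₂ * D).trace.re ≤ ∑ x with S < p x, p x := by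
    refine (hD1 _ hA₂).trans_eq ?_
    rw [trace_conjDiag hU1, Finset.sum_filter]
  have hTH := conjTranspose_conjDiag V c
  have hTH1 := conjTranspose_conjDiag V (1 - c)
  rw [← hT] at hTH
  rw [← hT1] at hTH1
  have h3 : (conjDiag U p₁ * D).trace.re ≤ 2 * (conjDiag U p₁ * (T * D * T)).trace.re +
      2 * (conjDiag U p₁ * ((1 - T) * D * (1 - T))).trace.re := by
    refine (trace_mul_mono hA₁ (posSemidef_pinching hD hTH)).trans_eq ?_
    rw [Matrix.mul_add, Matrix.mul_smul, Matrix.mul_smul, Matrix.trace_add, Matrix.trace_smul,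
      Matrix.trace_smul, Complex.add_re, Complex.smul_re, Complex.smul_re, smul_eq_mul, smul_eq_mul]
  -- The complement of `T` contributes at most the mass of the truncated `A` there, and truncation
  -- only decreases that mass.
  have h4 : (conjDiag U p₁ * ((1 - T) * D * (1 - T))).trace.re ≤
      ∑ y with q y < Q, ((Vᴴ * conjDiag U p * V) y y).re := by
    have hX := hA₁.mul_mul_conjTranspose_same (1 - T)
    rw [hTH1] at hX
    have e1 : (conjDiag U p₁ * ((1 - T) * D * (1 - T))).trace =
        ((1 - T) * conjDiag U p₁ * (1 - T) * D).trace := by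
      rw [← Matrix.mul_assoc, Matrix.trace_mul_comm]
      simp only [Matrix.mul_assoc]
    have e2 : ((1 - T) * conjDiag U p₁ * (1 - T)).trace = (conjDiag U p₁ * (1 - T)).trace := by
      rw [Matrix.mul_assoc, Matrix.trace_mul_comm, Matrix.mul_assoc, hT1, conjDiag_mul hV1]
      congr 3
      ext y
      rw [Pi.mul_apply, hc']
      split_ifs <;> simp
    rw [e1]
    refine (hD1 _ hX).trans ?_
    rw [e2, hT1, trace_mul_conjDiag, Finset.sum_filter]
    refine Finset.sum_le_sum fun y _ => ?_
    rw [hc']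
    split_ifs
    · rw [one_mul, hsplit, Matrix.mul_add, Matrix.add_mul, Matrix.add_apply, Complex.add_re]
      linarith [diag_conj_re_nonneg hA₂ V y]
    · rw [zero_mul]
  -- The truncated `A` is at most `S` times the identity; next, `Q • T` is at most `B`. Together
  -- they give the factor `S / Q`.
  have h5 : (conjDiag U p₁ * (T * D * T)).trace.re ≤ S * (T * D * T).trace.re := by
    have hX := hD.mul_mul_conjTranspose_same T
    rw [hTH] at hX
    have e1 : (T * D * T).trace.re = ∑ x, ((Uᴴ * (T * D * T) * U) x x).re := by
      have := trace_mul_conjDiag (T * D * T) U 1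
      rw [conjDiag_one hU2, Matrix.mul_one] at this
      simpa using this
    rw [Matrix.trace_mul_comm, trace_mul_conjDiag, e1, Finset.mul_sum]
    refine Finset.sum_le_sum fun x _ =>
      mul_le_mul_of_nonneg_right ?_ (diag_conj_re_nonneg hX U x)
    simp only [hp₁]
    split_ifs with h
    exacts [hS.le, not_lt.1 h]
  have h6 : (T * D * T).trace.re ≤ 1 / Q * (conjDiag V q * D).trace.re := by
    have e1 : (T * D * T).trace = (D * T).trace := by
      rw [Matrix.trace_mul_comm, ← Matrix.mul_assoc, hT, conjDiag_mul hV1, Matrix.trace_mul_comm]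
      congr 3
      ext y
      simp only [Pi.mul_apply, hc]
      split_ifs <;> simp
    rw [e1, hT, Matrix.trace_mul_comm (conjDiag V q), trace_mul_conjDiag, trace_mul_conjDiag,
      Finset.mul_sum]
    refine Finset.sum_le_sum fun y _ => ?_
    rw [← mul_assoc]
    refine mul_le_mul_of_nonneg_right ?_ (diag_conj_re_nonneg hD V y)
    simp only [hc]
    split_ifs with h
    · exact mul_nonneg (by positivity) (hq y)
    · rw [one_div, inv_mul_eq_div, le_div_iff₀ hQ, one_mul]
      exact not_lt.1 h
  have h7 := mul_le_mul_of_nonneg_left h6 hS.le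
  have h8 : S * (1 / Q * (conjDiag V q * D).trace.re) = S / Q * (conjDiag V q * D).trace.re := by
    ring
  linarith

end Test

/-! ### Tensor products of matrices and of spectral decompositions. -/

section Product

variable {d n : ℕ}

/-- The Kronecker product of a family of matrices. -/
def prodMat (A : Fin n → Matrix (Fin d) (Fin d) ℂ) : TensorOp d n :=
  Matrix.of fun x y => ∏ i, A i (x i) (y i)

theorem prodMat_mul (A B : Fin n → Matrix (Fin d) (Fin d) ℂ) :
    prodMat A * prodMat B = prodMat fun i => A i * B i := by
  ext x y
  simp only [prodMat, Matrix.mul_apply, Matrix.of_apply, ← Finset.prod_mul_distrib,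
    Fintype.prod_sum]

theorem conjTranspose_prodMat (A : Fin n → Matrix (Fin d) (Fin d) ℂ) :
    (prodMat A)ᴴ = prodMat fun i => (A i)ᴴ := by
  ext x y
  simp [prodMat, Matrix.conjTranspose_apply]

theorem prodMat_diagonal (a : Fin n → Fin d → ℂ) :
    prodMat (fun i => diagonal (a i)) = diagonal fun x => ∏ i, a i (x i) := by
  ext x y
  rw [prodMat, Matrix.of_apply]
  by_cases h : x = y
  · subst h
    simp
  · obtain ⟨i, hi⟩ := Function.ne_iff.1 h
    rw [Matrix.diagonal_apply_ne _ h]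
    exact Finset.prod_eq_zero (Finset.mem_univ i) (Matrix.diagonal_apply_ne _ hi)

theorem prodMat_one : prodMat (fun _ => 1 : Fin n → Matrix (Fin d) (Fin d) ℂ) = 1 := by
  have := prodMat_diagonal (fun (_ : Fin n) (_ : Fin d) => (1 : ℂ))
  simpa using this

theorem prodMat_conjDiag (U : Fin n → Matrix (Fin d) (Fin d) ℂ) (a : Fin n → Fin d → ℝ) :
    prodMat (fun i => conjDiag (U i) (a i)) =
      conjDiag (prodMat U) fun x => ∏ i, a i (x i) := by
  have h := prodMat_diagonal fun i j => ((a i j : ℝ) : ℂ)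
  simp only [conjDiag, ← prodMat_mul, ← conjTranspose_prodMat, h, Complex.ofReal_prod]

theorem trace_prodMat (A : Fin n → Matrix (Fin d) (Fin d) ℂ) :
    (prodMat A).trace = ∏ i, (A i).trace := by
  simp only [Matrix.trace, prodMat, Matrix.diag_apply, Matrix.of_apply, Fintype.prod_sum]

end Product

/-! ### Exponential tail bounds with uniform constants. -/

section Chernoff

/-- Only an upper bound on `u` is imposed, because logarithms of eigenvalues of a state are not
bounded below. -/
theorem exp_le_one_add_add_sq {u : ℝ} (hu : u ≤ 1) : Real.exp u ≤ 1 + u + u ^ 2 := by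
  rcases le_or_gt (-1) u with h | h
  · have := (abs_le.1 (Real.abs_exp_sub_one_sub_id_le (abs_le.2 ⟨h, hu⟩))).2
    linarith
  · have := Real.exp_le_one_iff.2 (by linarith : u ≤ 0)
    nlinarith

theorem sum_mul_exp_le {κ : Type*} [Fintype κ] {w g : κ → ℝ} (hw : ∀ j, 0 ≤ w j)
    (hw1 : ∑ j, w j = 1) {θ K : ℝ} (hg : ∀ j, θ * g j ≤ 1)
    (hK : ∑ j, w j * g j ^ 2 ≤ K) :
    ∑ j, w j * Real.exp (θ * g j) ≤ Real.exp (θ * ∑ j, w j * g j + θ ^ 2 * K) := by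
  calc ∑ j, w j * Real.exp (θ * g j) ≤ ∑ j, w j * (1 + θ * g j + (θ * g j) ^ 2) :=
        Finset.sum_le_sum fun j _ =>
          mul_le_mul_of_nonneg_left (exp_le_one_add_add_sq (hg j)) (hw j)
    _ = ∑ j, w j + θ * ∑ j, w j * g j + θ ^ 2 * ∑ j, w j * g j ^ 2 := by
        rw [Finset.mul_sum, Finset.mul_sum, ← Finset.sum_add_distrib, ← Finset.sum_add_distrib]
        exact Finset.sum_congr rfl fun j _ => by ring
    _ ≤ (θ * ∑ j, w j * g j + θ ^ 2 * K) + 1 := by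
        rw [hw1]
        linarith [mul_le_mul_of_nonneg_left hK (sq_nonneg θ)]
    _ ≤ _ := Real.add_one_le_exp _

/-- **Chernoff bound** for sums of independent, not identically distributed variables. -/
theorem chernoff {n : ℕ} {κ : Type*} [Fintype κ] {w g : Fin n → κ → ℝ} (hw : ∀ i j, 0 ≤ w i j)
    (hw1 : ∀ i, ∑ j, w i j = 1) {θ K γ : ℝ} (hθ : 0 ≤ θ) (hg : ∀ i j, θ * g i j ≤ 1)
    (hK : ∀ i, ∑ j, w i j * g i j ^ 2 ≤ K) (s : Finset (Fin n → κ))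
    (hs : ∀ x ∈ s, ∑ i, ∑ j, w i j * g i j + n * γ ≤ ∑ i, g i (x i)) :
    ∑ x ∈ s, ∏ i, w i (x i) ≤ Real.exp (n * (θ ^ 2 * K - θ * γ)) := by
  obtain ⟨T, hT⟩ : ∃ T, T = ∑ i, ∑ j, w i j * g i j + n * γ := ⟨_, rfl⟩
  rw [← hT] at hs
  have h0 : ∀ x : Fin n → κ, 0 ≤ ∏ i, w i (x i) := fun x => Finset.prod_nonneg fun i _ => hw i _
  have h1 : ∑ x ∈ s, ∏ i, w i (x i) ≤
      ∑ x : Fin n → κ, (∏ i, w i (x i)) * Real.exp (θ * (∑ i, g i (x i) - T)) :=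
    (Finset.sum_le_sum fun x hx => le_mul_of_one_le_right (h0 x)
      (Real.one_le_exp (mul_nonneg hθ (sub_nonneg.2 (hs x hx))))).trans
    (Finset.sum_le_sum_of_subset_of_nonneg (Finset.subset_univ s)
      fun x _ _ => mul_nonneg (h0 x) (Real.exp_pos _).le)
  have h2 : ∑ x : Fin n → κ, (∏ i, w i (x i)) * Real.exp (θ * (∑ i, g i (x i) - T)) =
      (∏ i, ∑ j, w i j * Real.exp (θ * g i j)) * Real.exp (-(θ * T)) := by
    rw [Fintype.prod_sum, Finset.sum_mul]
    refine Finset.sum_congr rfl fun x _ => ?_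
    rw [Finset.prod_mul_distrib, ← Real.exp_sum, mul_assoc, ← Real.exp_add, ← Finset.mul_sum]
    ring_nf
  have h3 : ∏ i, ∑ j, w i j * Real.exp (θ * g i j) ≤
      ∏ i, Real.exp (θ * ∑ j, w i j * g i j + θ ^ 2 * K) :=
    Finset.prod_le_prod
      (fun i _ => Finset.sum_nonneg fun j _ => mul_nonneg (hw i j) (Real.exp_pos _).le)
      fun i _ => sum_mul_exp_le (hw i) (hw1 i) (hg i) (hK i)
  refine (h1.trans_eq h2).trans
    ((mul_le_mul_of_nonneg_right h3 (Real.exp_pos _).le).trans_eq ?_)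
  rw [← Real.exp_sum, ← Real.exp_add, Finset.sum_add_distrib, ← Finset.mul_sum, hT]
  simp only [Finset.sum_const, Finset.card_univ, Fintype.card_fin, nsmul_eq_mul]
  ring_nf

/-- Write the left side as `4 * (√x * log √x) ^ 2`. It bounds the second moment of the
log-eigenvalues of a state independently of the state. -/
theorem mul_log_sq_le {x : ℝ} (h0 : 0 ≤ x) (h1 : x ≤ 1) : x * Real.log x ^ 2 ≤ 4 := by
  rcases h0.eq_or_lt with rfl | h0
  · simp
  · have hs := Real.sqrt_pos.2 h0
    have h2 := Real.abs_log_mul_self_lt _ hs (Real.sqrt_le_one.2 h1)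
    have h3 : x * Real.log x ^ 2 = 4 * (Real.log √x * √x) ^ 2 := by
      rw [Real.log_sqrt h0.le, mul_pow, Real.sq_sqrt h0.le]
      ring
    rw [h3]
    have h4 := (sq_lt_one_iff_abs_lt_one _).2 h2
    linarith

end Chernoff

/-! ### From tail bounds to the size of a code. -/

section Converse

variable {d n : ℕ}

theorem prodState_eq_prodMat (ρ : Fin n → State d) : prodState ρ = prodMat fun i => (ρ i).1 := rfl

/-- Measuring a product state in a product basis gives independent outcomes, which is what the
second Chernoff bound needs. -/
theorem conj_prodMat_diag_re (V A : Fin n → Matrix (Fin d) (Fin d) ℂ)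
    (hA : ∀ i, (A i).PosSemidef) (y : Fin n → Fin d) :
    (((prodMat V)ᴴ * prodMat A * prodMat V) y y).re =
      ∏ i, (((V i)ᴴ * A i * V i) (y i) (y i)).re := by
  have h : ∀ i, (((V i)ᴴ * A i * V i) (y i) (y i)) =
      (((((V i)ᴴ * A i * V i) (y i) (y i)).re : ℝ) : ℂ) := fun i =>
    Complex.ext rfl
      (Complex.le_def.1 ((hA i).conjTranspose_mul_mul_same (V i)).diag_nonneg).2.symm
  rw [conjTranspose_prodMat, prodMat_mul, prodMat_mul, prodMat, Matrix.of_apply,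
    Finset.prod_congr rfl fun i _ => h i, ← Complex.ofReal_prod, Complex.ofReal_re]

theorem isUnitary_prodMat {U : Fin n → Matrix (Fin d) (Fin d) ℂ} (h1 : ∀ i, (U i)ᴴ * U i = 1)
    (h2 : ∀ i, U i * (U i)ᴴ = 1) :
    (prodMat U)ᴴ * prodMat U = 1 ∧ prodMat U * (prodMat U)ᴴ = 1 := by
  rw [conjTranspose_prodMat, prodMat_mul, prodMat_mul]
  simp only [h1, h2, prodMat_one, and_self]

theorem eigenvalue_bounds {B : Matrix (Fin d) (Fin d) ℂ} {t : ℝ}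
    (hB : B.PosSemidef) (hBt : (B - t • (1 : Matrix (Fin d) (Fin d) ℂ)).PosSemidef) (j : Fin d) :
    t ≤ hB.isHermitian.eigenvalues j ∧ hB.isHermitian.eigenvalues j ≤ B.trace.re := by
  obtain ⟨V, hV1, hV2, hBV, -⟩ := exists_conjDiag hB.isHermitian
  have h1 := conjDiag_diag_re hV1 hB.isHermitian.eigenvalues j
  have h2 := trace_conjDiag hV1 hB.isHermitian.eigenvalues
  rw [← hBV] at h1 h2
  constructor
  · have h3 := diag_conj_re_nonneg hBt V j
    rw [Matrix.mul_sub, Matrix.sub_mul, Matrix.mul_smul, Matrix.smul_mul, Matrix.mul_one, hV1,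
      Matrix.sub_apply, Complex.sub_re, h1, Matrix.smul_apply, Matrix.one_apply_eq,
      Complex.smul_re, Complex.one_re, smul_eq_mul, mul_one] at h3
    linarith
  · rw [h2]
    exact Finset.single_le_sum (fun i _ => hB.eigenvalues_nonneg i) (Finset.mem_univ j)

/-- Strong converse bound for testing a product state against a product of well conditioned
positive operators. -/
theorem trace_prodState_mul_le (ρ : Fin n → State d) {B : Fin n → Matrix (Fin d) (Fin d) ℂ}
    {t : ℝ} (ht0 : 0 < t) (ht1 : t ≤ 1) (hB : ∀ i, (B i).PosSemidef)
    (hBt : ∀ i, (B i - t • (1 : Matrix (Fin d) (Fin d) ℂ)).PosSemidef)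
    (hBtr : ∀ i, (B i).trace.re ≤ 1 + 2 * t * d)
    {D : TensorOp d n} (hD : D.PosSemidef)
    (hD1 : ∀ X : TensorOp d n, X.PosSemidef → (X * D).trace.re ≤ X.trace.re)
    {θ γ : ℝ} (hθ : 0 ≤ θ) (hθL : θ * (2 * d + 1 / t) ≤ 1) :
    (prodState ρ * D).trace.re ≤
      3 * Real.exp (n * (θ ^ 2 * (4 * d + (2 * d + 1 / t) ^ 2) - θ * γ)) +
      2 * Real.exp (∑ i, (((ρ i).1 * cfc Real.log (ρ i).1).trace.re -
        ((ρ i).1 * cfc Real.log (B i)).trace.re) + 2 * n * γ) * (prodMat B * D).trace.re := by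
  set L : ℝ := 2 * d + 1 / t with hL
  have hd : (0 : ℝ) ≤ d := Nat.cast_nonneg d
  have hρ : ∀ i, (ρ i).1.PosSemidef := fun i => (ρ i).2.1
  choose U hU1 hU2 hρU hρf using fun i => exists_conjDiag (hρ i).isHermitian
  choose V hV1 hV2 hBV hBf using fun i => exists_conjDiag (hB i).isHermitian
  set p : Fin n → Fin d → ℝ := fun i => (hρ i).isHermitian.eigenvalues with hp
  set q : Fin n → Fin d → ℝ := fun i => (hB i).isHermitian.eigenvalues with hq
  set r : Fin n → Fin d → ℝ := fun i j => (((V i)ᴴ * (ρ i).1 * V i) j j).re with hr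
  have hp0 : ∀ i j, 0 ≤ p i j := fun i j => (hρ i).eigenvalues_nonneg j
  have hp1 : ∀ i, ∑ j, p i j = 1 := fun i => by
    rw [← trace_conjDiag (hU1 i), ← hρU i, (ρ i).trace_re]
  have hple : ∀ i j, p i j ≤ 1 := fun i j => by
    rw [← hp1 i]
    exact Finset.single_le_sum (fun k _ => hp0 i k) (Finset.mem_univ j)
  have hq0 : ∀ i j, 0 < q i j := fun i j =>
    ht0.trans_le (eigenvalue_bounds (hB i) (hBt i) j).1
  -- The eigenvalues lie between `t` and `1 + 2 * t * d`; apply `1 - 1 / x ≤ log x ≤ x - 1`.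
  have hqL : ∀ i j, |Real.log (q i j)| ≤ L := fun i j => by
    obtain ⟨b1, b2⟩ := eigenvalue_bounds (hB i) (hBt i) j
    have b3 := b2.trans (hBtr i)
    have b4 := Real.log_le_sub_one_of_pos (hq0 i j)
    have b5 := Real.one_sub_inv_le_log_of_pos (hq0 i j)
    have b6 : (q i j)⁻¹ ≤ 1 / t := by
      rw [one_div]
      exact inv_anti₀ ht0 b1
    have b7 : 2 * t * d ≤ 2 * d := by nlinarith
    have b8 : 0 < 1 / t := by positivity
    rw [abs_le]
    constructor
    · linarith
    · change q i j ≤ _ at b3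
      linarith
  have hr0 : ∀ i j, 0 ≤ r i j := fun i j => diag_conj_re_nonneg (hρ i) (V i) j
  have hr1 : ∀ i, ∑ j, r i j = 1 := fun i => by
    have h := trace_mul_conjDiag (ρ i).1 (V i) 1
    rw [conjDiag_one (hV2 i), Matrix.mul_one, (ρ i).trace_re] at h
    simpa using h.symm
  have hlogp : ∀ i, ∑ j, p i j * Real.log (p i j) =
      ((ρ i).1 * cfc Real.log (ρ i).1).trace.re := fun i => by
    rw [hρf, trace_mul_conjDiag]
    refine Finset.sum_congr rfl fun j _ => ?_
    have h : (((U i)ᴴ * (ρ i).1 * U i) j j).re = p i j := by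
      conv_lhs => rw [hρU i]
      exact conjDiag_diag_re (hU1 i) _ j
    rw [h]
    exact mul_comm _ _
  have hlogq : ∀ i, ∑ j, r i j * -Real.log (q i j) =
      -((ρ i).1 * cfc Real.log (B i)).trace.re := fun i => by
    rw [hBf, trace_mul_conjDiag, ← Finset.sum_neg_distrib]
    exact Finset.sum_congr rfl fun j _ => by simp only [Function.comp_apply]; ring
  -- The thresholds sit `n * γ` beyond the means: of `log p` under `p`, and of `log q` under the
  -- outcome distribution `r` of `ρ` in the eigenbasis of `B`.
  set S := Real.exp (∑ i, ∑ j, p i j * Real.log (p i j) + n * γ) with hS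
  set Q := Real.exp (-(∑ i, ∑ j, r i j * -Real.log (q i j) + n * γ)) with hQ
  obtain ⟨hPU1, hPU2⟩ := isUnitary_prodMat hU1 hU2
  obtain ⟨hPV1, hPV2⟩ := isUnitary_prodMat hV1 hV2
  have hst : prodState ρ = conjDiag (prodMat U) fun x => ∏ i, p i (x i) := by
    rw [prodState_eq_prodMat, ← prodMat_conjDiag]
    exact congrArg prodMat (funext hρU)
  have hBst : prodMat B = conjDiag (prodMat V) fun x => ∏ i, q i (x i) := by
    rw [← prodMat_conjDiag]
    exact congrArg prodMat (funext hBV)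
  have main := trace_mul_effect_le hPU1 hPU2 hPV1 hPV2
    (p := fun x : Fin n → Fin d => ∏ i, p i (x i)) (q := fun x : Fin n → Fin d => ∏ i, q i (x i))
    (fun x => Finset.prod_nonneg fun i _ => hp0 i _)
    (fun x => Finset.prod_nonneg fun i _ => (hq0 i _).le) hD hD1
    (S := S) (Q := Q) (Real.exp_pos _) (Real.exp_pos _)
  rw [← hst, ← hBst, prodState_eq_prodMat] at main
  simp only [conj_prodMat_diag_re V _ hρ] at main
  have hK1 : ∀ i, ∑ j, p i j * Real.log (p i j) ^ 2 ≤ 4 * d + L ^ 2 := fun i => by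
    calc ∑ j, p i j * Real.log (p i j) ^ 2 ≤ ∑ _j : Fin d, (4 : ℝ) :=
          Finset.sum_le_sum fun j _ => mul_log_sq_le (hp0 i j) (hple i j)
      _ = 4 * d := by simp [mul_comm]
      _ ≤ 4 * d + L ^ 2 := le_add_of_nonneg_right (sq_nonneg L)
  have hK2 : ∀ i, ∑ j, r i j * (-Real.log (q i j)) ^ 2 ≤ 4 * d + L ^ 2 := fun i => by
    calc ∑ j, r i j * (-Real.log (q i j)) ^ 2 ≤ ∑ j, r i j * L ^ 2 := by
          refine Finset.sum_le_sum fun j _ => mul_le_mul_of_nonneg_left ?_ (hr0 i j)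
          rw [neg_sq, ← sq_abs]
          exact pow_le_pow_left₀ (abs_nonneg _) (hqL i j) 2
      _ = L ^ 2 := by rw [← Finset.sum_mul, hr1, one_mul]
      _ ≤ 4 * d + L ^ 2 := le_add_of_nonneg_left (by positivity)
  have c1 := chernoff hp0 hp1 (g := fun i j => Real.log (p i j)) (γ := γ) hθ
    (fun i j => (mul_nonpos_of_nonneg_of_nonpos hθ
      (Real.log_nonpos (hp0 i j) (hple i j))).trans zero_le_one) hK1
    (Finset.univ.filter fun x : Fin n → Fin d => S < ∏ i, p i (x i)) fun x hx => by
      have hx' : S < ∏ i, p i (x i) := (Finset.mem_filter.1 hx).2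
      -- Zero eigenvalues, where `log 0 = 0` would mislead, do not occur above the positive
      -- threshold.
      have hne : ∀ i ∈ Finset.univ, p i (x i) ≠ 0 :=
        Finset.prod_ne_zero_iff.1 ((Real.exp_pos _).trans hx').ne'
      rw [← Real.log_prod hne]
      exact ((Real.lt_log_iff_exp_lt ((Real.exp_pos _).trans hx')).2 hx').le
  have c2 := chernoff hr0 hr1 (g := fun i j => -Real.log (q i j)) (γ := γ) hθ
    (fun i j => (mul_le_mul_of_nonneg_left ((neg_le_abs _).trans (hqL i j)) hθ).trans hθL) hK2
    (Finset.univ.filter fun x : Fin n → Fin d => ∏ i, q i (x i) < Q) fun x hx => by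
      have hx' : ∏ i, q i (x i) < Q := (Finset.mem_filter.1 hx).2
      have hpos : 0 < ∏ i, q i (x i) := Finset.prod_pos fun i _ => hq0 i _
      rw [Finset.sum_neg_distrib (s := Finset.univ) (f := fun i => Real.log (q i (x i))),
        ← Real.log_prod fun i _ => (hq0 i (x i)).ne']
      have := (Real.log_lt_iff_lt_exp hpos).2 hx'
      linarith
  have hSQ : S / Q = Real.exp (∑ i, (((ρ i).1 * cfc Real.log (ρ i).1).trace.re -
        ((ρ i).1 * cfc Real.log (B i)).trace.re) + 2 * n * γ) := by
    rw [hS, hQ, ← Real.exp_sub, Finset.sum_sub_distrib]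
    simp only [hlogp, hlogq, Finset.sum_neg_distrib]
    ring_nf
  rw [hSQ] at main
  rw [prodState_eq_prodMat]
  linarith

/-- A code whose code words are tested against a product operator with small relative entropies has
few messages. -/
theorem BlockCode.card_mul_le {W : ℕ → Set (State d)} (c : BlockCode W n) {lam : ℝ}
    (hc : c.error ≤ lam) {B : Fin n → Matrix (Fin d) (Fin d) ℂ} {C : Fin n → ℝ}
    {t : ℝ} (ht0 : 0 < t) (ht1 : t ≤ 1)
    (hBt : ∀ i, (B i - t • (1 : Matrix (Fin d) (Fin d) ℂ)).PosSemidef)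
    (hBtr : ∀ i, (B i).trace.re ≤ 1 + 2 * t * d)
    (hC : ∀ i : Fin n, ∀ ρ ∈ W i, (ρ.1 * cfc Real.log ρ.1).trace.re -
      (ρ.1 * cfc Real.log (B i)).trace.re ≤ C i)
    {θ γ : ℝ} (hθ : 0 ≤ θ) (hθL : θ * (2 * d + 1 / t) ≤ 1) :
    c.messages.card * (1 - lam -
      3 * Real.exp (n * (θ ^ 2 * (4 * d + (2 * d + 1 / t) ^ 2) - θ * γ))) ≤
      2 * Real.exp (∑ i, C i + 2 * n * γ) * Real.exp (2 * t * d * n) := by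
  have hB : ∀ i, (B i).PosSemidef := fun i => by
    have := (hBt i).add ((Matrix.PosSemidef.one (n := Fin d) (R := ℂ)).smul ht0.le)
    rwa [sub_add_cancel] at this
  have hBn : (prodMat B).PosSemidef := by
    choose V _ _ hBV _ using fun i => exists_conjDiag (hB i).isHermitian
    have : prodMat B = conjDiag (prodMat V) fun x => ∏ i, (hB i).isHermitian.eigenvalues (x i) := by
      rw [← prodMat_conjDiag]
      exact congrArg prodMat (funext hBV)
    rw [this]
    exact posSemidef_conjDiag _ fun x => Finset.prod_nonneg fun i _ => (hB i).eigenvalues_nonneg _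
  have hsum : ∀ X : TensorOp d n,
      HasSum (fun m => (X * c.observable m).trace.re) X.trace.re := fun X => by
    have h1 := (c.observable_sum.mul_left X).map
      (Complex.reAddGroupHom.comp (Matrix.traceAddMonoidHom (Fin n → Fin d) ℂ))
      (Complex.continuous_re.comp (continuous_id.matrix_trace))
    rw [mul_one] at h1
    exact h1
  -- Each decoding operator is at most the identity, tested against positive operators: it is one
  -- term of a nonnegative series.
  have heff : ∀ m, ∀ X : TensorOp d n, X.PosSemidef →
      (X * c.observable m).trace.re ≤ X.trace.re := fun m X hX =>
    le_hasSum (hsum X) m fun k _ => trace_mul_nonneg hX (c.observable_pos k)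
  set E := 3 * Real.exp (n * (θ ^ 2 * (4 * d + (2 * d + 1 / t) ^ 2) - θ * γ)) with hE
  set G := 2 * Real.exp (∑ i, C i + 2 * n * γ) with hG
  have hmsg : ∀ m : c.messages,
      1 - lam - E ≤ G * (prodMat B * c.observable m).trace.re := fun m => by
    have h1 : 1 - (c.codeword m * c.observable m).trace.re ≤ lam :=
      (le_ciSup (f := fun m : c.messages => 1 - (c.codeword m * c.observable m).trace.re)
        (Set.finite_range _).bddAbove m).trans hc
    have h2 := trace_prodState_mul_le (fun i => (c.encode m i : State d)) ht0 ht1 hB hBt hBtr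
      (c.observable_pos m) (heff m) (γ := γ) hθ hθL
    have h3 : ∑ i, (((c.encode m i : State d).1 * cfc Real.log (c.encode m i : State d).1).trace.re
        - ((c.encode m i : State d).1 * cfc Real.log (B i)).trace.re) ≤ ∑ i, C i :=
      Finset.sum_le_sum fun i _ => hC i _ (c.encode m i).2
    have h4 : 2 * Real.exp (∑ i, (((c.encode m i : State d).1 *
        cfc Real.log (c.encode m i : State d).1).trace.re
        - ((c.encode m i : State d).1 * cfc Real.log (B i)).trace.re) + 2 * n * γ) ≤ G := by
      rw [hG]
      gcongr
    have h5 := mul_le_mul_of_nonneg_right h4 (trace_mul_nonneg hBn (c.observable_pos m))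
    change 1 - (prodState (fun i => (c.encode m i : State d)) * c.observable m).trace.re ≤ lam at h1
    linarith
  have hG0 : 0 ≤ G := by positivity
  have htr : (prodMat B).trace.re ≤ Real.exp (2 * t * d * n) := by
    have h1 : ∀ i, (B i).trace = (((B i).trace.re : ℝ) : ℂ) := fun i =>
      Complex.ext rfl (Complex.le_def.1 (hB i).trace_nonneg).2.symm
    rw [trace_prodMat, Finset.prod_congr rfl fun i _ => h1 i, ← Complex.ofReal_prod,
      Complex.ofReal_re]
    calc ∏ i, (B i).trace.re ≤ ∏ _i : Fin n, Real.exp (2 * t * d) :=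
          Finset.prod_le_prod (fun i _ => (Complex.le_def.1 (hB i).trace_nonneg).1) fun i _ =>
            (hBtr i).trans (by rw [add_comm]; exact Real.add_one_le_exp _)
      _ = Real.exp (2 * t * d * n) := by
          rw [Finset.prod_const, Finset.card_univ, Fintype.card_fin, ← Real.exp_nat_mul, mul_comm]
  calc c.messages.card * (1 - lam - E) = ∑ _m ∈ c.messages, (1 - lam - E) := by
        rw [Finset.sum_const, nsmul_eq_mul]
    _ ≤ ∑ m ∈ c.messages, G * (prodMat B * c.observable m).trace.re :=
        Finset.sum_le_sum fun m hm => hmsg ⟨m, hm⟩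
    _ = G * ∑ m ∈ c.messages, (prodMat B * c.observable m).trace.re := by rw [Finset.mul_sum]
    _ ≤ G * (prodMat B).trace.re := mul_le_mul_of_nonneg_left
        (sum_le_hasSum _ (fun k _ => trace_mul_nonneg hBn (c.observable_pos k)) (hsum _)) hG0
    _ ≤ G * Real.exp (2 * t * d * n) := mul_le_mul_of_nonneg_left htr hG0

end Converse

end

end QChannel

/-! ### Choice of parameters and conclusion. -/

theorem mainTheorem2 (d : ℕ) (lam ε : ℝ) (hlam₀ : 0 < lam) (hlam₁ : lam < 1) (hε : 0 < ε) :
    ∃ n₀ : ℕ, ∀ n : ℕ, n₀ ≤ n →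
      ∀ W : ℕ → Set (QChannel.State d), (∀ i, (W i).Nonempty) →
        Real.logb 2 (QChannel.maxCodeSize W n lam : ℝ) ≤
          ∑ i ∈ Finset.range n, QChannel.capacity (W i) + (n : ℝ) * ε := by
  have hd : (0 : ℝ) ≤ d := Nat.cast_nonneg d
  have hl2 : 0 < Real.log 2 := Real.log_pos one_lt_two
  obtain ⟨e, he⟩ : ∃ e, e = ε * Real.log 2 := ⟨_, rfl⟩
  have he0 : 0 < e := he ▸ mul_pos hε hl2
  -- Budget per letter, in natural logarithms: `e / 4` for the centre's entropy and trace errors, `e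
  -- / 4` for `2 * γ` with `γ = e / 8`, and `e / 2` for the constant `4 / (1 - lam)`.
  obtain ⟨t, ht0, ht1, hte⟩ : ∃ t : ℝ, 0 < t ∧ t ≤ 1 ∧ t * (1 + d) + 2 * t * d ≤ e / 4 := by
    refine ⟨min 1 (e / (4 * (1 + 3 * d))), lt_min one_pos (by positivity), min_le_left _ _, ?_⟩
    have h1 := min_le_right 1 (e / (4 * (1 + 3 * d)))
    rw [le_div_iff₀ (by positivity)] at h1
    linarith
  obtain ⟨L, hL⟩ : ∃ L : ℝ, L = 2 * d + 1 / t := ⟨_, rfl⟩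
  have hL0 : 0 < L := by rw [hL]; positivity
  obtain ⟨K, hK⟩ : ∃ K : ℝ, K = 4 * d + L ^ 2 := ⟨_, rfl⟩
  have hK0 : 0 < K := by rw [hK]; positivity
  -- With `θ * K` at most half of `γ`, the Chernoff exponent is at most `-n * θ * (e / 16)`.
  obtain ⟨θ, hθ0, hθL, hθK⟩ : ∃ θ : ℝ, 0 < θ ∧ θ * L ≤ 1 ∧ θ * K ≤ e / 16 := by
    refine ⟨min (1 / L) (e / 16 / K), lt_min (by positivity) (by positivity), ?_, ?_⟩
    · exact (le_div_iff₀ hL0).1 (min_le_left _ _)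
    · exact (le_div_iff₀ hK0).1 (min_le_right _ _)
  have hlam : 0 < 1 - lam := sub_pos.2 hlam₁
  -- From `n₁` on, each exponential is at most `(1 - lam) / 6`, so the three together use half of `1
  -- - lam`.
  obtain ⟨n₁, hn₁⟩ := exists_nat_ge (-Real.log ((1 - lam) / 6) / (θ * (e / 16)))
  obtain ⟨n₂, hn₂⟩ := exists_nat_ge (Real.log (4 / (1 - lam)) / (e / 2))
  refine ⟨max n₁ n₂, fun n hn W hW => ?_⟩
  have hn1 : -Real.log ((1 - lam) / 6) ≤ n * (θ * (e / 16)) := by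
    rw [← div_le_iff₀ (by positivity)]
    exact hn₁.trans (by exact_mod_cast (le_max_left _ _).trans hn)
  have hn2 : Real.log (4 / (1 - lam)) ≤ n * (e / 2) := by
    rw [← div_le_iff₀ (by positivity)]
    exact hn₂.trans (by exact_mod_cast (le_max_right _ _).trans hn)
  have hn0 : (0 : ℝ) ≤ n := Nat.cast_nonneg n
  have hsum0 : 0 ≤ ∑ i ∈ Finset.range n, QChannel.capacity (W i) :=
    Finset.sum_nonneg fun i _ => QChannel.capacity_nonneg (hW i)
  obtain ⟨c, hc, hcard⟩ := (QChannel.maxCodeSize_isGreatest W n hlam₀.le hlam₁).1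
  rcases Nat.eq_zero_or_pos (QChannel.maxCodeSize W n lam) with h0 | hpos
  -- Here `logb 2 0 = 0`, and the right side is nonnegative.
  · rw [h0, Nat.cast_zero, Real.logb_zero]
    positivity
  choose B hBt hBtr hBC using fun i : Fin n =>
    QChannel.exists_capacity_center (hW i) ht0 ht1
  have key := c.card_mul_le hc ht0 ht1 hBt hBtr hBC (γ := e / 8) hθ0.le (hL ▸ hθL)
  rw [hcard, ← hL, ← hK, mul_assoc 2, ← Real.exp_add] at key
  set N := QChannel.maxCodeSize W n lam with hN
  have hNpos : (0 : ℝ) < N := Nat.cast_pos.2 hpos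
  have hexp : Real.exp (n * (θ ^ 2 * K - θ * (e / 8))) ≤ (1 - lam) / 6 := by
    rw [← Real.le_log_iff_exp_le (by positivity)]
    have h1 : θ ^ 2 * K ≤ θ * (e / 16) := by nlinarith
    have h2 : n * (θ ^ 2 * K - θ * (e / 8)) ≤ n * -(θ * (e / 16)) :=
      mul_le_mul_of_nonneg_left (by linarith) hn0
    linarith
  have hsum : ∑ i : Fin n, (QChannel.capacity (W i) * Real.log 2 + t * (1 + d)) =
      (∑ i ∈ Finset.range n, QChannel.capacity (W i)) * Real.log 2 + n * (t * (1 + d)) := by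
    rw [Finset.sum_add_distrib, ← Finset.sum_mul,
      Fin.sum_univ_eq_sum_range (fun i => QChannel.capacity (W i)), Finset.sum_const,
      Finset.card_univ, Fintype.card_fin, nsmul_eq_mul]
  rw [hsum] at key
  have hfin : (N : ℝ) ≤ 4 / (1 - lam) *
      Real.exp ((∑ i ∈ Finset.range n, QChannel.capacity (W i)) * Real.log 2 +
        n * (t * (1 + d)) + 2 * n * (e / 8) + 2 * t * d * n) := by
    have h1 : N * ((1 - lam) / 2) ≤ 2 *
      Real.exp ((∑ i ∈ Finset.range n, QChannel.capacity (W i)) * Real.log 2 +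
        n * (t * (1 + d)) + 2 * n * (e / 8) + 2 * t * d * n) :=
      (mul_le_mul_of_nonneg_left (by linarith) hNpos.le).trans key
    rw [← le_div_iff₀ (by positivity)] at h1
    refine h1.trans_eq ?_
    field_simp
    ring
  have hlog := Real.log_le_log hNpos hfin
  rw [Real.log_mul (by positivity) (Real.exp_pos _).ne', Real.log_exp] at hlog
  rw [Real.logb, div_le_iff₀ hl2, add_mul, mul_assoc (n : ℝ), ← he]
  have h3 := mul_le_mul_of_nonneg_left hte hn0
  linarith
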